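/- For every integer $n\ge 0$ and real $t$ let $$Q_n(t)=\sum_{k=0}^{n} k!\,\binom{n}{k}^2(-t)^k .$$ Then, for every integer $n\ge 1$, $$\left|Q_n(1)-(-1)^n\sqrt{\frac{e}{\pi}}\cdot\frac{n!}{n^{1/4}}\cos\left(2\sqrt{n}-\frac{\pi}{4}\right)\right|<\frac{2.38\,n!}{n^{3/4}} .$$ -/

import Mathlib

/-- The polynomial `Q_n(t) = ∑_{k=0}^{n} k! * (n choose k)^2 * (-t)^k`, evaluated at a real `t`
(the denominator polynomial in the Padé identity of Euler's factorial series). -/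
noncomputable def padeQ (n : ℕ) (t : ℝ) : ℝ :=
  ∑ k ∈ Finset.range (n + 1), (Nat.factorial k : ℝ) * (Nat.choose n k : ℝ) ^ 2 * (-t) ^ k

/-!
Reversing the sum gives `Q_n(1) = (-1)^n n! L_n(1)`, with `L_n` the Laguerre polynomial, so the
claim is Fejér's asymptotic formula for `L_n(1)` with an explicit error.

Integrating the power series of the Bessel function `J₀` term by term and using Kummer's
transformation, one finds (`integral_exp_neg_mul_pow_mul_besselJZero`)
`∫₀^∞ e^{-t} t^n J₀(2√t) dt = n! e⁻¹ L_n(1)`.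
The Gamma weight `e^{-t} t^n / n!` sits at `t = n + O(√n)`, which reduces everything to two explicit
estimates.

* `abs_besselJZero_two_mul_sqrt_sub_le`: for all `t > 0`, `J₀(2√t)` differs from
  `π^{-1/2} t^{-1/4} cos (2√t - π/4)` by at most `t^{-3/4} / (16√π)`. Poisson's integral for `J₀` is
  shifted, by Cauchy's theorem, to the ray `1 + i[0, ∞)` (`besselJZero_eq_integral`), where its
  kernel is compared with an exact Gamma integral.
* `norm_integral_sub_leading_le`: the Gamma average of `t^{-1/4} exp (2i√t)` is
  `n^{-1/4} e^{-1/2} exp (2i√n)` up to `O(n^{-3/4})`. Replacing the phase `2√t` by its tangent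
  `√n + t/√n` at `t = n` costs `(√t - √n)² / √n`, whose average is a combination of Gamma values.
  What is left is the Gamma integral at the complex rate `1 - i/√n` (`integral_rpow_mul_cexp`), and
  `(1 - i/√n)^{-(n + 3/4)}` is close to `e^{-1/2} e^{i√n}`.

Since the leading factor is `e · π^{-1/2} · e^{-1/2} = √(e/π)`, collecting the errors gives the
constant `(9e/16 + 21√e/16) / √π < 2.09`, uniformly in `n ≥ 1`.
-/

open MeasureTheory Set Filter Topology

/-! ### The Gamma integral at a complex rate -/

lemma integrableOn_rpow_mul_cexp {a : ℝ} {r : ℂ} (ha : 0 < a) (hr : 0 < r.re) :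
    IntegrableOn (fun t : ℝ => ((t ^ (a - 1) : ℝ) : ℂ) * Complex.exp (-(r * t))) (Ioi 0) := by
  have h := integrableOn_rpow_mul_exp_neg_mul_rpow (s := a - 1) (p := 1) (b := r.re)
    (by linarith) one_pos hr
  refine Integrable.mono' h ?_ ?_
  · apply Measurable.aestronglyMeasurable
    fun_prop
  · refine (ae_restrict_mem measurableSet_Ioi).mono fun t ht => ?_
    have ht : 0 < t := ht
    rw [norm_mul, Complex.norm_exp, Complex.norm_real, Real.norm_of_nonneg (by positivity)]
    simp

/-- Euler's integral at a complex rate `r` with `0 < r.re`. Both sides are holomorphic in `r` and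
agree for positive real `r`. -/
lemma integral_rpow_mul_cexp {a : ℝ} {r : ℂ} (ha : 0 < a) (hr : 0 < r.re) :
    ∫ t in Ioi (0 : ℝ), ((t ^ (a - 1) : ℝ) : ℂ) * Complex.exp (-(r * t)) =
      (1 / r) ^ (a : ℂ) * Real.Gamma a := by
  set U : Set ℂ := {z : ℂ | 0 < z.re} with hU
  have hUo : IsOpen U := isOpen_lt continuous_const Complex.continuous_re
  set F : ℂ → ℂ := fun r => ∫ t in Ioi (0 : ℝ), ((t ^ (a - 1) : ℝ) : ℂ) * Complex.exp (-(r * t))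
  have hF : DifferentiableOn ℂ F U := by
    intro w hw
    have hw : 0 < w.re := hw
    have hball : ∀ x ∈ Metric.ball w (w.re / 2), w.re / 2 ≤ x.re := by
      intro x hx
      have h1 : |(x - w).re| ≤ ‖x - w‖ := Complex.abs_re_le_norm _
      rw [mem_ball_iff_norm] at hx
      have := (abs_le.1 (h1.trans hx.le)).1
      simp at this
      linarith
    have := hasDerivAt_integral_of_dominated_loc_of_deriv_le (μ := volume.restrict (Ioi (0 : ℝ)))
      (F := fun (r : ℂ) (t : ℝ) => ((t ^ (a - 1) : ℝ) : ℂ) * Complex.exp (-(r * t)))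
      (F' := fun (r : ℂ) (t : ℝ) => ((t ^ (a - 1) : ℝ) : ℂ) * (Complex.exp (-(r * t)) * (-t)))
      (x₀ := w) (s := Metric.ball w (w.re / 2))
      (bound := fun t => t ^ a * Real.exp (-(w.re / 2) * t ^ (1 : ℝ)))
      (Metric.ball_mem_nhds _ (by linarith))
      (Filter.Eventually.of_forall fun x => by
        apply Measurable.aestronglyMeasurable; fun_prop)
      (integrableOn_rpow_mul_cexp ha hw)
      (by apply Measurable.aestronglyMeasurable; fun_prop)
      ?_ (integrableOn_rpow_mul_exp_neg_mul_rpow (by linarith) one_pos (by linarith)) ?_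
    · exact this.2.differentiableAt.differentiableWithinAt
    · refine (ae_restrict_mem measurableSet_Ioi).mono fun t ht x hx => ?_
      have ht : 0 < t := ht
      rw [norm_mul, norm_mul, Complex.norm_exp, Complex.norm_real,
        Real.norm_of_nonneg (by positivity), norm_neg, Complex.norm_real,
        Real.norm_of_nonneg ht.le]
      have e : t ^ a = t ^ (a - 1) * t := by
        rw [← Real.rpow_add_one ht.ne']; simp
      have : Real.exp (-(x * t)).re ≤ Real.exp (-(w.re / 2) * t ^ (1 : ℝ)) := by
        apply Real.exp_le_exp.2
        simp only [Complex.neg_re, Complex.re_mul_ofReal, Real.rpow_one]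
        nlinarith [hball x hx]
      rw [e]
      calc _ = t ^ (a - 1) * t * Real.exp (-(x * t)).re := by ring
        _ ≤ _ := by gcongr
    · refine Filter.Eventually.of_forall fun t x hx => ?_
      have h1 : HasDerivAt (fun x : ℂ => -(x * (t : ℂ))) (-(1 * (t : ℂ))) x :=
        ((hasDerivAt_id x).mul_const _).neg
      rw [one_mul] at h1
      exact h1.cexp.const_mul _
  have hG : DifferentiableOn ℂ (fun r : ℂ => (1 / r) ^ (a : ℂ) * (Real.Gamma a : ℂ)) U := by
    intro w hw
    have hw : 0 < w.re := hw
    have hw0 : w ≠ 0 := by rintro rfl; simp at hw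
    refine DifferentiableAt.differentiableWithinAt ?_
    refine DifferentiableAt.mul_const ?_ _
    refine DifferentiableAt.cpow ((differentiableAt_const _).div differentiableAt_id hw0)
      (differentiableAt_const _) (Or.inl ?_)
    rw [one_div, Complex.inv_re]
    exact div_pos hw (Complex.normSq_pos.2 hw0)
  have key := (hF.analyticOnNhd hUo).eqOn_of_preconnected_of_frequently_eq
    (hG.analyticOnNhd hUo) (z₀ := 1) (convex_halfSpace_re_gt 0).isPreconnected (by simp [hU]) ?_
  · exact key hr
  -- The real points `1 + 1 / (n + 1)` accumulate at `1`.
  · have hlim : Filter.Tendsto (fun n : ℕ => ((1 + 1 / ((n : ℝ) + 1) : ℝ) : ℂ)) Filter.atTop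
        (nhdsWithin 1 {1}ᶜ) := by
      refine tendsto_nhdsWithin_iff.2 ⟨?_, Filter.Eventually.of_forall fun n => ?_⟩
      · have := (tendsto_one_div_add_atTop_nhds_zero_nat (𝕜 := ℝ)).const_add 1
        rw [add_zero] at this
        exact (Complex.continuous_ofReal.tendsto 1).comp this
      · simp only [mem_compl_iff, mem_singleton_iff]
        norm_cast
        have : (0 : ℝ) < 1 / ((n : ℝ) + 1) := by positivity
        push_cast at this ⊢
        linarith
    refine hlim.frequently (Filter.Frequently.of_forall fun n => ?_)
    set b : ℝ := 1 + 1 / ((n : ℝ) + 1)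
    have hb : 0 < b := by positivity
    have h := Complex.integral_cpow_mul_exp_neg_mul_Ioi (a := a) (r := b) (by simpa using ha) hb
    rw [Complex.Gamma_ofReal] at h
    rw [← h]
    refine setIntegral_congr_fun measurableSet_Ioi fun t ht => ?_
    have ht : 0 < t := ht
    rw [Complex.ofReal_cpow ht.le]
    push_cast
    rfl

/-! ### Laguerre values as Gamma averages of the Bessel function -/

open Finset in
/-- Reversing the order of summation shows `Q_n(1) = (-1)^n n! L_n(1)`, with `L_n` the Laguerre
polynomial `L_n(x) = ∑ j, (n choose j) (-x)^j / j!`. -/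
lemma padeQ_one_eq (n : ℕ) : padeQ n 1 =
    (-1) ^ n * n.factorial * ∑ j ∈ range (n + 1), (n.choose j : ℝ) * ((-1) ^ j / j.factorial) := by
  rw [padeQ, ← sum_range_reflect, mul_sum]
  refine sum_congr rfl fun j hj => ?_
  have hj : j ≤ n := Nat.lt_succ_iff.1 (mem_range.1 hj)
  have e : n + 1 - 1 - j = n - j := by omega
  rw [e, Nat.choose_symm hj]
  have h1 : ((n.choose j * j.factorial * (n - j).factorial : ℕ) : ℝ) = n.factorial := by
    rw [Nat.choose_mul_factorial_mul_factorial hj]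
  have h2 : ((-1 : ℝ)) ^ n = (-1) ^ (n - j) * (-1) ^ j := by rw [← pow_add]; congr 1; omega
  have h3 : ((-1 : ℝ)) ^ j * (-1) ^ j = 1 := by rw [← mul_pow]; simp
  have h4 : (j.factorial : ℝ) ≠ 0 := by positivity
  rw [h2, ← h1]
  push_cast
  field_simp
  linear_combination (-(n.choose j : ℝ) ^ 2) * h3

lemma hasSum_neg_one_pow_mul_choose_div_factorial (j : ℕ) :
    HasSum (fun k : ℕ => (-1 : ℝ) ^ k * (k.choose j : ℝ) / k.factorial)
      (Real.exp (-1) * ((-1) ^ j / j.factorial)) := by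
  rw [← hasSum_nat_add_iff' j]
  have h0 : ∑ i ∈ Finset.range j, (-1 : ℝ) ^ i * (i.choose j : ℝ) / i.factorial = 0 := by
    refine Finset.sum_eq_zero fun i hi => ?_
    rw [Nat.choose_eq_zero_of_lt (Finset.mem_range.1 hi)]
    simp
  rw [h0, sub_zero]
  have h := (NormedSpace.expSeries_div_hasSum_exp (-1 : ℝ)).mul_right ((-1 : ℝ) ^ j / j.factorial)
  rw [← Real.exp_eq_exp_ℝ] at h
  refine h.congr_fun fun k => ?_
  have h1 : (((k + j).choose j * j.factorial * k.factorial : ℕ) : ℝ) = (k + j).factorial := by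
    have := Nat.choose_mul_factorial_mul_factorial (Nat.le_add_left j k)
    rw [Nat.add_sub_cancel] at this
    rw [this]
  rw [← h1, pow_add]
  have h4 : (j.factorial : ℝ) ≠ 0 := by positivity
  have h5 : (k.factorial : ℝ) ≠ 0 := by positivity
  have h6 : ((k + j).choose j : ℝ) ≠ 0 := by
    have := Nat.choose_pos (Nat.le_add_left j k)
    positivity
  push_cast
  field_simp

/-- The case of Kummer's transformation `₁F₁(n + 1; 1; -1) = e⁻¹ ₁F₁(-n; 1; 1)` that is needed,
obtained by expanding `(n + k choose n)` with Vandermonde's identity. -/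
lemma hasSum_neg_one_pow_mul_add_choose_div_factorial (n : ℕ) :
    HasSum (fun k : ℕ => (-1 : ℝ) ^ k * ((n + k).choose n : ℝ) / k.factorial)
      (Real.exp (-1) *
        ∑ j ∈ Finset.range (n + 1), (n.choose j : ℝ) * ((-1) ^ j / j.factorial)) := by
  rw [Finset.mul_sum]
  have h := hasSum_sum (s := Finset.range (n + 1)) fun j _ =>
    (hasSum_neg_one_pow_mul_choose_div_factorial j).mul_left (n.choose j : ℝ)
  have e : ∀ k : ℕ, ((n + k).choose n : ℝ) =
      ∑ j ∈ Finset.range (n + 1), (n.choose j : ℝ) * (k.choose j : ℝ) := by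
    intro k
    rw [add_comm, Nat.add_choose_eq, Finset.Nat.sum_antidiagonal_eq_sum_range_succ_mk]
    push_cast
    refine Finset.sum_congr rfl fun j hj => ?_
    have hj : j ≤ n := Nat.lt_succ_iff.1 (Finset.mem_range.1 hj)
    simp only [Nat.choose_symm hj]
    ring
  have e2 : ∀ j : ℕ, (n.choose j : ℝ) * (Real.exp (-1) * ((-1) ^ j / j.factorial)) =
      Real.exp (-1) * ((n.choose j : ℝ) * ((-1) ^ j / j.factorial)) := fun j => by ring
  simp only [e2] at h
  refine h.congr_fun fun k => ?_
  rw [e, Finset.mul_sum, Finset.sum_div]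
  exact Finset.sum_congr rfl fun j _ => by ring

/-- The Bessel function `J₀` on the real line, given by Bessel's integral. -/
noncomputable def besselJZero (z : ℝ) : ℝ :=
  2 / Real.pi * ∫ θ in (0 : ℝ)..Real.pi / 2, Real.cos (z * Real.cos θ)

lemma integral_cos_pow_even (k : ℕ) :
    2 / Real.pi * ∫ θ in (0 : ℝ)..Real.pi / 2, Real.cos θ ^ (2 * k) =
    (2 * k).factorial / (4 ^ k * (k.factorial : ℝ) ^ 2) := by
  rw [EulerSine.integral_cos_pow_eq, integral_sin_pow_even]
  have hpi := Real.pi_ne_zero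
  have : ∀ k : ℕ, ∏ i ∈ Finset.range k, (2 * (i : ℝ) + 1) / (2 * i + 2) =
      (2 * k).factorial / (4 ^ k * (k.factorial : ℝ) ^ 2) := by
    intro k
    induction k with
    | zero => simp
    | succ k ih =>
      rw [Finset.prod_range_succ, ih, show 2 * (k + 1) = 2 * k + 1 + 1 by ring,
        Nat.factorial_succ, Nat.factorial_succ, Nat.factorial_succ]
      push_cast
      have h5 : (k.factorial : ℝ) ≠ 0 := by positivity
      have h6 : (k : ℝ) + 1 ≠ 0 := by positivity
      field_simp
      ring
  rw [this]
  field_simp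

lemma hasSum_besselJZero (z : ℝ) :
    HasSum (fun k : ℕ => (-1 : ℝ) ^ k * (z / 2) ^ (2 * k) / (k.factorial : ℝ) ^ 2)
      (besselJZero z) := by
  have h := intervalIntegral.hasSum_integral_of_dominated_convergence (μ := volume)
    (a := 0) (b := Real.pi / 2) (f := fun θ => Real.cos (z * Real.cos θ))
    (F := fun (k : ℕ) (θ : ℝ) => (-1) ^ k * (z * Real.cos θ) ^ (2 * k) / ((2 * k).factorial : ℝ))
    (fun k _ => |z| ^ (2 * k) / ((2 * k).factorial : ℝ))
    (fun k => by
      apply Continuous.aestronglyMeasurable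
      fun_prop)
    (fun k => Filter.Eventually.of_forall fun θ _ => ?_)
    (Filter.Eventually.of_forall fun θ _ => ?_)
    (by exact intervalIntegrable_const)
    (Filter.Eventually.of_forall fun θ _ => Real.hasSum_cos _)
  · have h2 := h.mul_left (2 / Real.pi)
    refine h2.congr_fun fun k => ?_
    have e : ∀ θ : ℝ, (-1) ^ k * (z * Real.cos θ) ^ (2 * k) / ((2 * k).factorial : ℝ) =
        ((-1) ^ k * z ^ (2 * k) / ((2 * k).factorial : ℝ)) * Real.cos θ ^ (2 * k) := by
      intro θ; rw [mul_pow]; ring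
    simp only [e]
    rw [intervalIntegral.integral_const_mul, mul_left_comm, integral_cos_pow_even, div_pow,
      pow_mul 2 2 k]
    have h5 : ((2 * k).factorial : ℝ) ≠ 0 := by positivity
    norm_num
    field_simp
  · rw [norm_div, norm_mul, norm_pow, norm_neg, norm_one, one_pow, one_mul, norm_pow, norm_mul,
      Real.norm_natCast, Real.norm_eq_abs, Real.norm_eq_abs]
    gcongr
    exact mul_le_of_le_one_right (abs_nonneg _) (Real.abs_cos_le_one θ)
  · exact (Real.summable_pow_div_factorial |z|).comp_injective
      (i := fun k => 2 * k) (fun a b h => by simpa using h)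

lemma integral_exp_neg_mul_pow (m : ℕ) :
    ∫ t in Ioi (0 : ℝ), Real.exp (-t) * t ^ m = m.factorial := by
  rw [← Real.Gamma_nat_eq_factorial, Real.Gamma_eq_integral (by positivity)]
  simp

lemma integrableOn_exp_neg_mul_pow (m : ℕ) :
    IntegrableOn (fun t : ℝ => Real.exp (-t) * t ^ m) (Ioi 0) := by
  have := Real.GammaIntegral_convergent (s := m + 1) (by positivity)
  simpa using this

/-- The Laguerre value `L_n(1)` is, up to the factor `e`, the mean of `J₀(2√t)` under the Gamma
distribution with shape `n + 1`: integrate the power series of `J₀` term by term. -/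
lemma integral_exp_neg_mul_pow_mul_besselJZero (n : ℕ) :
    ∫ t in Ioi (0 : ℝ), Real.exp (-t) * t ^ n * besselJZero (2 * √t) =
      n.factorial * (Real.exp (-1) *
        ∑ j ∈ Finset.range (n + 1), (n.choose j : ℝ) * ((-1) ^ j / j.factorial)) := by
  have e : ∀ (k : ℕ), ∀ t ∈ Ioi (0 : ℝ),
      Real.exp (-t) * t ^ n * ((-1 : ℝ) ^ k * (2 * √t / 2) ^ (2 * k) / (k.factorial : ℝ) ^ 2) =
      (-1) ^ k / (k.factorial : ℝ) ^ 2 * (Real.exp (-t) * t ^ (n + k)) := by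
    intro k t ht
    have ht : 0 < t := ht
    rw [mul_div_cancel_left₀ _ (two_ne_zero), pow_mul, Real.sq_sqrt ht.le, pow_add]
    ring
  have hfac : ∀ k : ℕ, ((n + k).factorial : ℝ) = (n + k).choose n * n.factorial * k.factorial := by
    intro k
    have := Nat.choose_mul_factorial_mul_factorial (Nat.le_add_right n k)
    rw [Nat.add_sub_cancel_left] at this
    exact_mod_cast this.symm
  have h := hasSum_integral_of_summable_integral_norm (μ := volume.restrict (Ioi (0 : ℝ)))
    (F := fun (k : ℕ) (t : ℝ) => (-1 : ℝ) ^ k / (k.factorial : ℝ) ^ 2 *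
      (Real.exp (-t) * t ^ (n + k)))
    (fun k => (integrableOn_exp_neg_mul_pow (n + k)).const_mul _) ?_
  · have h3 := (hasSum_neg_one_pow_mul_add_choose_div_factorial n).mul_left (n.factorial : ℝ)
    rw [h3.unique (h.congr_fun fun k => ?_)]
    · refine setIntegral_congr_fun measurableSet_Ioi fun t ht => ?_
      have := (hasSum_besselJZero (2 * √t)).mul_left (Real.exp (-t) * t ^ n)
      simp only [e _ t ht] at this
      exact this.tsum_eq.symm
    · rw [integral_const_mul, integral_exp_neg_mul_pow, hfac]
      have h5 : (k.factorial : ℝ) ≠ 0 := by positivity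
      field_simp
  · have e2 : ∀ k : ℕ, ∫ t in Ioi (0 : ℝ), ‖(-1 : ℝ) ^ k / (k.factorial : ℝ) ^ 2 *
        (Real.exp (-t) * t ^ (n + k))‖ = n.factorial * ((n + k).choose n / k.factorial) := by
      intro k
      have : ∀ t ∈ Ioi (0 : ℝ), ‖(-1 : ℝ) ^ k / (k.factorial : ℝ) ^ 2 *
        (Real.exp (-t) * t ^ (n + k))‖ = 1 / (k.factorial : ℝ) ^ 2 *
        (Real.exp (-t) * t ^ (n + k)) := by
        intro t ht
        have ht : 0 < t := ht
        rw [norm_mul, norm_div, norm_pow, norm_neg, norm_one, one_pow,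
          Real.norm_of_nonneg (by positivity), Real.norm_of_nonneg (by positivity)]
      rw [setIntegral_congr_fun measurableSet_Ioi this, integral_const_mul,
        integral_exp_neg_mul_pow, hfac]
      have h5 : (k.factorial : ℝ) ≠ 0 := by positivity
      field_simp
    simp only [e2]
    refine Summable.mul_left _ ?_
    refine Summable.of_nonneg_of_le (fun k => by positivity) (fun k => ?_)
      ((Real.summable_pow_div_factorial 2).mul_left (2 ^ n))
    rw [← mul_div_assoc, ← pow_add]
    gcongr
    exact_mod_cast Nat.choose_le_two_pow _ _

/-! ### Hankel's representation of the Bessel function -/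

/-- The integrand `e^{izs} (1 - s²)^{-1/2}` of Poisson's representation of `J₀(z)`. The square root
is split as `(1 - s)^{-1/2} (1 + s)^{-1/2}`, so that the principal branches are holomorphic on the
half strip `0 ≤ re s < 1`, `0 ≤ im s`. -/
noncomputable def besselKernel (z : ℝ) (s : ℂ) : ℂ :=
  Complex.exp (Complex.I * z * s) * (1 - s) ^ ((-(1 / 2) : ℝ) : ℂ) * (1 + s) ^ ((-(1 / 2) : ℝ) : ℂ)

lemma differentiableAt_besselKernel (z : ℝ) {s : ℂ} (h1 : 1 - s ∈ Complex.slitPlane)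
    (h2 : 1 + s ∈ Complex.slitPlane) : DifferentiableAt ℂ (besselKernel z) s := by
  unfold besselKernel
  have e1 : DifferentiableAt ℂ (fun s : ℂ => 1 - s) s := by fun_prop
  have e2 : DifferentiableAt ℂ (fun s : ℂ => 1 + s) s := by fun_prop
  exact (DifferentiableAt.mul (by fun_prop) (e1.cpow (differentiableAt_const _) h1)).mul
    (e2.cpow (differentiableAt_const _) h2)

lemma differentiableAt_besselKernel_add_mul_I (z : ℝ) {a y : ℝ} (ha : 0 ≤ a)
    (hy : a < 1 ∨ a = 1 ∧ 0 < y) :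
    DifferentiableAt ℂ (besselKernel z) (a + y * Complex.I) := by
  refine differentiableAt_besselKernel z ?_ ?_
  · rcases hy with h | ⟨_, h⟩
    · left; simpa using h
    · right; simpa using h.ne'
  · left; simp; linarith

lemma norm_besselKernel_le (z : ℝ) {a y : ℝ} (ha : 0 ≤ a) (hy : 0 < y) :
    ‖besselKernel z (a + y * Complex.I)‖ ≤ Real.exp (-(z * y)) * y ^ (-(1 / 2) : ℝ) := by
  rw [besselKernel, norm_mul, norm_mul, Complex.norm_exp, Complex.norm_cpow_real,
    Complex.norm_cpow_real]
  have e : (Complex.I * z * (a + y * Complex.I)).re = -(z * y) := by simp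
  have h1 : y ≤ ‖1 - (a + y * Complex.I)‖ := by
    have := Complex.abs_im_le_norm (1 - (a + y * Complex.I))
    simp only [Complex.sub_im, Complex.one_im, Complex.add_im, Complex.ofReal_im, Complex.mul_im,
      Complex.ofReal_re, Complex.I_im, Complex.I_re, mul_one, mul_zero, zero_add, add_zero, zero_sub,
      abs_neg, abs_of_pos hy] at this
    exact this
  have h2 : 1 ≤ ‖1 + (a + y * Complex.I)‖ := by
    have := (le_abs_self _).trans (Complex.abs_re_le_norm (1 + (a + y * Complex.I)))
    simp at this
    linarith
  rw [e]
  have h3 := Real.rpow_le_rpow_of_nonpos hy h1 (by norm_num : (-(1 / 2) : ℝ) ≤ 0)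
  have h4 := Real.rpow_le_one_of_one_le_of_nonpos h2 (by norm_num : (-(1 / 2) : ℝ) ≤ 0)
  calc _ ≤ Real.exp (-(z * y)) * y ^ (-(1 / 2) : ℝ) * 1 := by gcongr
    _ = _ := mul_one _

lemma integrableOn_exp_neg_mul_rpow {z s : ℝ} (hz : 0 < z) (hs : -1 < s) :
    IntegrableOn (fun y : ℝ => Real.exp (-(z * y)) * y ^ s) (Ioi 0) := by
  refine (integrableOn_rpow_mul_exp_neg_mul_rpow (s := s) (p := 1) (b := z) hs one_pos hz).congr_fun
    (fun y _ => ?_) measurableSet_Ioi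
  simp [mul_comm]

lemma aestronglyMeasurable_besselKernel (z a : ℝ) :
    AEStronglyMeasurable (fun y : ℝ => besselKernel z (a + y * Complex.I))
      (volume.restrict (Ioi 0)) := by
  apply Measurable.aestronglyMeasurable
  unfold besselKernel
  fun_prop

lemma integrableOn_besselKernel {z a : ℝ} (hz : 0 < z) (ha : 0 ≤ a) :
    IntegrableOn (fun y : ℝ => besselKernel z (a + y * Complex.I)) (Ioi 0) :=
  Integrable.mono' (integrableOn_exp_neg_mul_rpow hz (s := -(1 / 2)) (by norm_num))
    (aestronglyMeasurable_besselKernel z a)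
    ((ae_restrict_mem measurableSet_Ioi).mono fun _ hy => norm_besselKernel_le z ha hy)

lemma besselKernel_ofReal_re (z : ℝ) {x : ℝ} (h0 : -1 < x) (h1 : x < 1) :
    (besselKernel z x).re = Real.cos (z * x) / √(1 - x ^ 2) := by
  have e1 : (1 - x : ℂ) ^ ((-(1 / 2) : ℝ) : ℂ) = ((1 - x) ^ (-(1 / 2) : ℝ) : ℝ) := by
    rw [Complex.ofReal_cpow (by linarith)]; push_cast; rfl
  have e2 : (1 + x : ℂ) ^ ((-(1 / 2) : ℝ) : ℂ) = ((1 + x) ^ (-(1 / 2) : ℝ) : ℝ) := by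
    rw [Complex.ofReal_cpow (by linarith)]; push_cast; rfl
  rw [besselKernel, e1, e2, mul_assoc, ← Complex.ofReal_mul, Complex.re_mul_ofReal,
    ← Real.mul_rpow (by linarith) (by linarith), Real.rpow_neg (by nlinarith), ← Real.sqrt_eq_rpow,
    show (1 - x) * (1 + x) = 1 - x ^ 2 by ring, Complex.exp_re]
  simp
  rfl

/-- On the imaginary axis the kernel is real, so that this side of the contour does not contribute
to the real part of the contour integral. -/
lemma besselKernel_mul_I_im (z y : ℝ) : (besselKernel z (y * Complex.I)).im = 0 := by
  rw [← Complex.conj_eq_iff_im, besselKernel]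
  have h1 : (1 + y * Complex.I).arg ≠ Real.pi :=
    Complex.slitPlane_arg_ne_pi (Or.inl (by simp))
  have h2 : (1 - y * Complex.I).arg ≠ Real.pi :=
    Complex.slitPlane_arg_ne_pi (Or.inl (by simp))
  have c1 : (starRingEnd ℂ) ((1 + y * Complex.I) ^ ((-(1 / 2) : ℝ) : ℂ)) =
      (1 - y * Complex.I) ^ ((-(1 / 2) : ℝ) : ℂ) := by
    have := Complex.conj_cpow (1 + y * Complex.I) ((-(1 / 2) : ℝ) : ℂ) h1
    rw [Complex.conj_ofReal] at this
    rw [← this]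
    simp [sub_eq_add_neg]
  have c2 : (starRingEnd ℂ) ((1 - y * Complex.I) ^ ((-(1 / 2) : ℝ) : ℂ)) =
      (1 + y * Complex.I) ^ ((-(1 / 2) : ℝ) : ℂ) := by
    have := Complex.conj_cpow (1 - y * Complex.I) ((-(1 / 2) : ℝ) : ℂ) h2
    rw [Complex.conj_ofReal] at this
    rw [← this]
    simp
  rw [map_mul, map_mul, c1, c2, ← Complex.exp_conj]
  have e : (starRingEnd ℂ) (Complex.I * z * (y * Complex.I)) = Complex.I * z * (y * Complex.I) := by
    simp only [map_mul, Complex.conj_I, Complex.conj_ofReal]; ring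
  rw [e]
  ring

/-- Cauchy's theorem on the rectangle with corners `0` and `a + iR`, followed by `R → ∞`. Stopping
at `a < 1` keeps the branch point `s = 1` off the contour. -/
lemma integral_cos_div_sqrt_eq {z a : ℝ} (hz : 0 < z) (ha : 0 ≤ a) (ha1 : a < 1) :
    ∫ x in (0 : ℝ)..a, Real.cos (z * x) / √(1 - x ^ 2) =
      (∫ y in Ioi (0 : ℝ), besselKernel z (a + y * Complex.I)).im := by
  have hcont : ∀ b : ℝ, 0 ≤ b → b < 1 →
      Continuous fun y : ℝ => besselKernel z (b + y * Complex.I) := by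
    intro b hb hb1
    refine continuous_iff_continuousAt.2 fun y => ?_
    exact ContinuousAt.comp (f := fun y : ℝ => (b + y * Complex.I : ℂ))
      (differentiableAt_besselKernel_add_mul_I z hb (Or.inl hb1)).continuousAt
      (by fun_prop)
  have hcontH : ∀ R : ℝ,
      ContinuousOn (fun x : ℝ => besselKernel z (x + R * Complex.I)) (uIcc 0 a) := by
    intro R x hx
    rw [uIcc_of_le ha] at hx
    exact (ContinuousAt.comp (f := fun x : ℝ => (x + R * Complex.I : ℂ))
      (differentiableAt_besselKernel_add_mul_I z hx.1
        (Or.inl (hx.2.trans_lt ha1))).continuousAt (by fun_prop)).continuousWithinAt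
  have hrect : ∀ R : ℝ, 0 ≤ R → (∫ x in (0 : ℝ)..a, Real.cos (z * x) / √(1 - x ^ 2)) =
      (∫ x in (0 : ℝ)..a, besselKernel z (x + R * Complex.I)).re +
        (∫ y in (0 : ℝ)..R, besselKernel z (a + y * Complex.I)).im := by
    intro R hR
    have h := Complex.integral_boundary_rect_eq_zero_of_differentiableOn (besselKernel z)
      0 (a + R * Complex.I) ?_
    · simp only [Complex.zero_re, Complex.zero_im, Complex.add_re, Complex.ofReal_re,
        Complex.mul_re, Complex.I_re, Complex.I_im, Complex.ofReal_im, Complex.add_im,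
        Complex.mul_im, mul_zero, mul_one, zero_mul, add_zero, zero_add, sub_self,
        Complex.ofReal_zero, smul_eq_mul] at h
      have h2 := congrArg Complex.re h
      have i1 : (∫ x in (0 : ℝ)..a, besselKernel z x).re =
          ∫ x in (0 : ℝ)..a, Real.cos (z * x) / √(1 - x ^ 2) := by
        rw [← Complex.reCLM_apply, ← ContinuousLinearMap.intervalIntegral_comp_comm]
        · refine intervalIntegral.integral_congr fun x hx => ?_
          rw [uIcc_of_le ha] at hx
          exact besselKernel_ofReal_re z (by linarith [hx.1]) (hx.2.trans_lt ha1)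
        · have := (hcontH 0).intervalIntegrable (μ := volume)
          simpa using this
      have i2 : (∫ y in (0 : ℝ)..R, besselKernel z (y * Complex.I)).im = 0 := by
        rw [← Complex.imCLM_apply, ← ContinuousLinearMap.intervalIntegral_comp_comm]
        · simp [besselKernel_mul_I_im]
        · have := (hcont 0 le_rfl one_pos).intervalIntegrable (μ := volume) 0 R
          simpa using this
      simp only [Complex.add_re, Complex.sub_re, Complex.mul_re, Complex.I_re, Complex.I_im,
        zero_mul, one_mul, zero_sub, Complex.zero_re, i1, i2] at h2
      linarith
    · intro s hs
      simp only [Complex.zero_re, Complex.zero_im, Complex.add_re, Complex.ofReal_re,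
        Complex.mul_re, Complex.I_re, Complex.I_im, Complex.ofReal_im, Complex.add_im,
        Complex.mul_im, mul_zero, mul_one, add_zero, zero_add, sub_self,
        uIcc_of_le ha, uIcc_of_le hR] at hs
      have := differentiableAt_besselKernel_add_mul_I z (a := s.re) (y := s.im) hs.1.1
        (Or.inl (hs.1.2.trans_lt ha1))
      rw [Complex.re_add_im] at this
      exact this.differentiableWithinAt
  have hlim1 : Tendsto (fun R : ℝ => ∫ x in (0 : ℝ)..a, besselKernel z (x + R * Complex.I))
      atTop (𝓝 0) := by
    have hb : Tendsto (fun R : ℝ => Real.exp (-(z * R)) * a) atTop (𝓝 0) := by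
      have : Tendsto (fun R : ℝ => Real.exp (-(z * R))) atTop (𝓝 0) :=
        Real.tendsto_exp_neg_atTop_nhds_zero.comp (tendsto_id.const_mul_atTop hz)
      simpa using this.mul_const a
    refine squeeze_zero_norm' ?_ hb
    filter_upwards [eventually_ge_atTop 1] with R hR
    have := intervalIntegral.norm_integral_le_of_norm_le_const (a := 0) (b := a)
      (f := fun x : ℝ => besselKernel z (x + R * Complex.I)) (C := Real.exp (-(z * R))) ?_
    · simpa [abs_of_nonneg ha] using this
    · intro x hx
      rw [uIoc_of_le ha] at hx
      refine (norm_besselKernel_le z hx.1.le (by linarith)).trans ?_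
      exact mul_le_of_le_one_right (Real.exp_nonneg _)
        (Real.rpow_le_one_of_one_le_of_nonpos hR (by norm_num))
  have hlim2 := intervalIntegral_tendsto_integral_Ioi 0 (integrableOn_besselKernel hz ha) tendsto_id
  have hlim := ((Complex.continuous_re.tendsto _).comp hlim1).add
    ((Complex.continuous_im.tendsto _).comp hlim2)
  rw [Complex.zero_re, zero_add] at hlim
  refine tendsto_nhds_unique (tendsto_const_nhds.congr' ?_) hlim
  filter_upwards [eventually_ge_atTop 0] with R hR
  exact hrect R hR

/-- Hankel's representation: Poisson's integral for `J₀` is moved to the ray `1 + i[0, ∞)`, where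
the kernel decays exponentially. It arises from the truncated integrals over `[0, cos δ]` in the
limit `δ → 0`. -/
lemma besselJZero_eq_integral {z : ℝ} (hz : 0 < z) :
    besselJZero z =
      2 / Real.pi * (∫ y in Ioi (0 : ℝ), besselKernel z ((1 : ℝ) + y * Complex.I)).im := by
  have hpi := Real.pi_pos
  have hsub : ∀ δ ∈ Ioo (0 : ℝ) (Real.pi / 2),
      ∫ θ in δ..Real.pi / 2, Real.cos (z * Real.cos θ) =
        (∫ y in Ioi (0 : ℝ), besselKernel z (Real.cos δ + y * Complex.I)).im := by
    intro δ hδ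
    have hc0 : 0 ≤ Real.cos δ := Real.cos_nonneg_of_mem_Icc ⟨by linarith [hδ.1], hδ.2.le⟩
    have hc1 : Real.cos δ < 1 := by
      rw [← Real.cos_zero]
      exact Real.cos_lt_cos_of_nonneg_of_le_pi le_rfl (by linarith [hδ.2]) hδ.1
    rw [← integral_cos_div_sqrt_eq hz hc0 hc1]
    have h := intervalIntegral.integral_comp_mul_deriv'' (a := δ) (b := Real.pi / 2)
      (f := Real.cos) (f' := fun θ => -Real.sin θ)
      (g := fun x => Real.cos (z * x) / √(1 - x ^ 2)) Real.continuous_cos.continuousOn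
      (fun θ _ => (Real.hasDerivAt_cos θ).hasDerivWithinAt)
      (by fun_prop) ?_
    · rw [Real.cos_pi_div_two, intervalIntegral.integral_symm 0, ← neg_eq_iff_eq_neg] at h
      rw [← h, ← intervalIntegral.integral_neg]
      refine intervalIntegral.integral_congr fun θ hθ => ?_
      rw [uIcc_of_le hδ.2.le] at hθ
      have hs : 0 < Real.sin θ := Real.sin_pos_of_pos_of_lt_pi (hδ.1.trans_le hθ.1)
        (by linarith [hθ.2])
      simp only [Function.comp]
      rw [← Real.sin_sq, Real.sqrt_sq hs.le]
      field_simp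
    · rintro _ ⟨θ, hθ, rfl⟩
      rw [uIcc_of_le hδ.2.le] at hθ
      have hs : 0 < Real.sin θ := Real.sin_pos_of_pos_of_lt_pi (hδ.1.trans_le hθ.1)
        (by linarith [hθ.2])
      refine ContinuousAt.continuousWithinAt ?_
      refine ContinuousAt.div (by fun_prop) (by fun_prop) ?_
      rw [← Real.sin_sq, Real.sqrt_sq hs.le]
      exact hs.ne'
  have hL : Tendsto (fun δ : ℝ => ∫ θ in δ..Real.pi / 2, Real.cos (z * Real.cos θ)) (𝓝[>] 0)
      (𝓝 (∫ θ in (0 : ℝ)..Real.pi / 2, Real.cos (z * Real.cos θ))) := by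
    have hc : Continuous fun θ : ℝ => Real.cos (z * Real.cos θ) := by fun_prop
    have h := intervalIntegral.continuous_primitive (μ := volume)
      (fun a b => hc.intervalIntegrable a b) (Real.pi / 2)
    have h2 : Tendsto (fun δ : ℝ => -∫ θ in Real.pi / 2..δ, Real.cos (z * Real.cos θ)) (𝓝 0)
        (𝓝 (-∫ θ in Real.pi / 2..0, Real.cos (z * Real.cos θ))) := (h.tendsto 0).neg
    simp only [← intervalIntegral.integral_symm] at h2
    exact h2.mono_left nhdsWithin_le_nhds
  have hR : Tendsto (fun δ : ℝ => ∫ y in Ioi (0 : ℝ), besselKernel z (Real.cos δ + y * Complex.I))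
      (𝓝[>] 0) (𝓝 (∫ y in Ioi (0 : ℝ), besselKernel z ((1 : ℝ) + y * Complex.I))) := by
    have hev : ∀ᶠ δ in 𝓝[>] (0 : ℝ), δ ∈ Ioo 0 (Real.pi / 2) :=
      Ioo_mem_nhdsGT (by linarith)
    refine tendsto_integral_filter_of_dominated_convergence
      (fun y => Real.exp (-(z * y)) * y ^ (-(1 / 2) : ℝ))
      (Eventually.of_forall fun δ => aestronglyMeasurable_besselKernel z _) ?_
      (integrableOn_exp_neg_mul_rpow hz (by norm_num)) ?_
    · filter_upwards [hev] with δ hδ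
      refine (ae_restrict_mem measurableSet_Ioi).mono fun y hy => ?_
      exact norm_besselKernel_le z
        (Real.cos_nonneg_of_mem_Icc ⟨by linarith [hδ.1], hδ.2.le⟩) hy
    · refine (ae_restrict_mem measurableSet_Ioi).mono fun y hy => ?_
      have h1 := (differentiableAt_besselKernel_add_mul_I z (a := 1) (y := y) zero_le_one
        (Or.inr ⟨rfl, hy⟩)).continuousAt
      have h2 : Tendsto (fun δ : ℝ => ((Real.cos δ : ℝ) + y * Complex.I : ℂ)) (𝓝[>] 0)
          (𝓝 ((1 : ℝ) + y * Complex.I)) := by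
        have : Continuous fun δ : ℝ => ((Real.cos δ : ℝ) + y * Complex.I : ℂ) := by fun_prop
        have := this.tendsto 0
        rw [Real.cos_zero] at this
        exact this.mono_left nhdsWithin_le_nhds
      exact h1.tendsto.comp h2
  have hR2 := (Complex.continuous_im.tendsto _).comp hR
  rw [besselJZero]
  congr 1
  refine tendsto_nhds_unique hL (hR2.congr' ?_)
  filter_upwards [Ioo_mem_nhdsGT (show (0 : ℝ) < Real.pi / 2 by linarith)] with δ hδ
  exact (hsub δ hδ).symm

/-! ### Bessel asymptotics with an explicit error -/

lemma norm_two_add_mul_I_cpow_sub_le {y : ℝ} (hy : 0 ≤ y) :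
    ‖(2 + y * Complex.I) ^ ((-(1 / 2) : ℝ) : ℂ) - ((2 ^ (-(1 / 2) : ℝ) : ℝ) : ℂ)‖ ≤
      2 ^ (-(5 / 2) : ℝ) * y := by
  have hd : ∀ x ∈ Icc (0 : ℝ) y, HasDerivWithinAt
      (fun x : ℝ => (2 + x * Complex.I) ^ ((-(1 / 2) : ℝ) : ℂ))
      (((-(1 / 2) : ℝ) : ℂ) * (2 + x * Complex.I) ^ ((-(3 / 2) : ℝ) : ℂ) * Complex.I)
      (Icc 0 y) x := by
    intro x _
    have h1 : HasDerivAt (fun s : ℂ => 2 + s * Complex.I) Complex.I (x : ℂ) := by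
      simpa using ((hasDerivAt_id (x : ℂ)).mul_const Complex.I).const_add 2
    have h2 := (h1.cpow_const (c := ((-(1 / 2) : ℝ) : ℂ)) (Or.inl (by simp))).comp_ofReal
    have e : ((-(1 / 2) : ℝ) : ℂ) - 1 = ((-(3 / 2) : ℝ) : ℂ) := by push_cast; ring
    rw [e] at h2
    exact h2.hasDerivWithinAt
  have hb : ∀ x ∈ Ico (0 : ℝ) y,
      ‖((-(1 / 2) : ℝ) : ℂ) * (2 + x * Complex.I) ^ ((-(3 / 2) : ℝ) : ℂ) * Complex.I‖ ≤
        2 ^ (-(5 / 2) : ℝ) := by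
    intro x _
    rw [norm_mul, norm_mul, Complex.norm_I, mul_one, Complex.norm_cpow_real, Complex.norm_real]
    have h1 : (2 : ℝ) ≤ ‖(2 + x * Complex.I : ℂ)‖ := by
      have := (le_abs_self _).trans (Complex.abs_re_le_norm (2 + x * Complex.I))
      simpa using this
    have h2 := Real.rpow_le_rpow_of_nonpos two_pos h1 (by norm_num : (-(3 / 2) : ℝ) ≤ 0)
    have e : (2 : ℝ) ^ (-(5 / 2) : ℝ) = 1 / 2 * 2 ^ (-(3 / 2) : ℝ) := by
      rw [show (-(5 / 2) : ℝ) = -1 + -(3 / 2) by norm_num, Real.rpow_add two_pos, Real.rpow_neg_one]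
      norm_num
    rw [e, norm_neg, Real.norm_of_nonneg (by norm_num)]
    gcongr
  have h := norm_image_sub_le_of_norm_deriv_le_segment' hd hb y (right_mem_Icc.2 hy)
  have e : ((2 : ℂ) + (0 : ℝ) * Complex.I) ^ ((-(1 / 2) : ℝ) : ℂ) =
      ((2 ^ (-(1 / 2) : ℝ) : ℝ) : ℂ) := by
    rw [Complex.ofReal_cpow two_pos.le]; simp
  rw [e, sub_zero] at h
  exact h

lemma besselKernel_one_add_mul_I (z : ℝ) {y : ℝ} (hy : 0 < y) :
    besselKernel z ((1 : ℝ) + y * Complex.I) =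
      ((Real.exp (-(z * y)) * y ^ (-(1 / 2) : ℝ) : ℝ) : ℂ) *
        Complex.exp ((z + Real.pi / 4 : ℝ) * Complex.I) *
        (2 + y * Complex.I) ^ ((-(1 / 2) : ℝ) : ℂ) := by
  have h1 : (1 - (((1 : ℝ) : ℂ) + y * Complex.I)) ^ ((-(1 / 2) : ℝ) : ℂ) =
      ((y ^ (-(1 / 2) : ℝ) : ℝ) : ℂ) * Complex.exp ((Real.pi / 4 : ℝ) * Complex.I) := by
    have e : (1 - (((1 : ℝ) : ℂ) + y * Complex.I)) = y * -Complex.I := by push_cast; ring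
    rw [e, Complex.cpow_def_of_ne_zero (by simp [hy.ne']), Complex.log_ofReal_mul hy (by simp),
      Complex.log_neg_I, Real.rpow_def_of_pos hy, Complex.ofReal_exp, ← Complex.exp_add]
    congr 1
    push_cast
    ring
  have h2 : Complex.exp (Complex.I * z * (((1 : ℝ) : ℂ) + y * Complex.I)) =
      (Real.exp (-(z * y)) : ℝ) * Complex.exp (z * Complex.I) := by
    rw [Complex.ofReal_exp, ← Complex.exp_add]
    congr 1
    push_cast
    linear_combination (z * y : ℂ) * Complex.I_mul_I
  have h3 : Complex.exp ((z + Real.pi / 4 : ℝ) * Complex.I) =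
      Complex.exp (z * Complex.I) * Complex.exp ((Real.pi / 4 : ℝ) * Complex.I) := by
    rw [← Complex.exp_add]
    congr 1
    push_cast
    ring
  rw [besselKernel, h1, h2, h3]
  push_cast
  ring_nf

/-- The leading Bessel asymptotics with an explicit error, valid for all `z > 0`: in Hankel's
representation replace `(2 + iy)^{-1/2}` by its value at `y = 0`. -/
lemma abs_besselJZero_sub_le {z : ℝ} (hz : 0 < z) :
    |besselJZero z - 2 / Real.pi * (2 ^ (-(1 / 2) : ℝ) * ((1 / z) ^ (1 / 2 : ℝ) * √Real.pi)) *
      Real.cos (z - Real.pi / 4)| ≤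
      2 / Real.pi * (2 ^ (-(5 / 2) : ℝ) * ((1 / z) ^ (3 / 2 : ℝ) * (√Real.pi / 2))) := by
  have hpi := Real.pi_pos
  have hI : ∀ s : ℝ, -1 < s → ∫ y in Ioi (0 : ℝ), Real.exp (-(z * y)) * y ^ s =
      (1 / z) ^ (s + 1) * Real.Gamma (s + 1) := by
    intro s hs
    rw [← Real.integral_rpow_mul_exp_neg_mul_Ioi (by linarith) hz]
    simp [mul_comm]
  have hI1 : ∫ y in Ioi (0 : ℝ), Real.exp (-(z * y)) * y ^ (-(1 / 2) : ℝ) =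
      (1 / z) ^ (1 / 2 : ℝ) * √Real.pi := by
    rw [hI _ (by norm_num), ← Real.Gamma_one_half_eq]; norm_num
  have hI2 : ∫ y in Ioi (0 : ℝ), Real.exp (-(z * y)) * y ^ (1 / 2 : ℝ) =
      (1 / z) ^ (3 / 2 : ℝ) * (√Real.pi / 2) := by
    rw [hI _ (by norm_num), Real.Gamma_add_one (by norm_num), Real.Gamma_one_half_eq,
      show (1 / 2 : ℝ) + 1 = 3 / 2 by norm_num]
    ring
  set u : ℂ := Complex.exp ((z + Real.pi / 4 : ℝ) * Complex.I)
  have hu : ‖u‖ = 1 := Complex.norm_exp_ofReal_mul_I _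
  have hui : u.im = Real.cos (z - Real.pi / 4) := by
    rw [Complex.exp_ofReal_mul_I_im, ← Real.cos_pi_div_two_sub, ← Real.cos_neg]
    congr 1
    ring
  have hint0 := integrableOn_exp_neg_mul_rpow hz (s := -(1 / 2)) (by norm_num)
  set k0 : ℝ → ℂ := fun y => ((Real.exp (-(z * y)) * y ^ (-(1 / 2) : ℝ) : ℝ) : ℂ) *
    (u * ((2 ^ (-(1 / 2) : ℝ) : ℝ) : ℂ)) with hk0
  have hk0i : IntegrableOn k0 (Ioi 0) := Integrable.mul_const hint0.ofReal _
  have hk0e : ∫ y in Ioi (0 : ℝ), k0 y = (((1 / z) ^ (1 / 2 : ℝ) * √Real.pi : ℝ) : ℂ) *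
      (u * ((2 ^ (-(1 / 2) : ℝ) : ℝ) : ℂ)) := by
    rw [hk0, integral_mul_const, integral_complex_ofReal, hI1]
  have hdiff : ‖(∫ y in Ioi (0 : ℝ), besselKernel z ((1 : ℝ) + y * Complex.I)) -
      ∫ y in Ioi (0 : ℝ), k0 y‖ ≤ 2 ^ (-(5 / 2) : ℝ) * ((1 / z) ^ (3 / 2 : ℝ) * (√Real.pi / 2)) := by
    rw [← integral_sub (integrableOn_besselKernel hz zero_le_one) hk0i, ← hI2,
      ← integral_const_mul]
    refine norm_integral_le_of_norm_le
      ((integrableOn_exp_neg_mul_rpow hz (by norm_num)).const_mul _) ?_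
    refine (ae_restrict_mem measurableSet_Ioi).mono fun y hy => ?_
    have hy : 0 < y := hy
    rw [besselKernel_one_add_mul_I z hy, hk0]
    simp only
    rw [mul_assoc, ← mul_sub, ← mul_sub, norm_mul, norm_mul, hu, one_mul, Complex.norm_real,
      Real.norm_of_nonneg (by positivity)]
    have e : y ^ (1 / 2 : ℝ) = y ^ (-(1 / 2) : ℝ) * y := by
      rw [← Real.rpow_add_one hy.ne']; norm_num
    rw [e]
    calc _ ≤ Real.exp (-(z * y)) * y ^ (-(1 / 2) : ℝ) * (2 ^ (-(5 / 2) : ℝ) * y) := by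
          gcongr
          exact norm_two_add_mul_I_cpow_sub_le hy.le
      _ = _ := by ring
  have him := (Complex.abs_im_le_norm _).trans hdiff
  rw [Complex.sub_im, hk0e, Complex.im_ofReal_mul, Complex.im_mul_ofReal, hui] at him
  rw [besselJZero_eq_integral hz]
  calc _ = 2 / Real.pi * |(∫ y in Ioi (0 : ℝ), besselKernel z ((1 : ℝ) + y * Complex.I)).im -
        (1 / z) ^ (1 / 2 : ℝ) * √Real.pi * (Real.cos (z - Real.pi / 4) * 2 ^ (-(1 / 2) : ℝ))| := by
        rw [← abs_of_pos (show 0 < 2 / Real.pi by positivity), ← abs_mul,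
          abs_of_pos (show 0 < 2 / Real.pi by positivity)]
        congr 1
        ring
    _ ≤ _ := by gcongr

lemma abs_besselJZero_two_mul_sqrt_sub_le {t : ℝ} (ht : 0 < t) :
    |besselJZero (2 * √t) - t ^ (-(1 / 4) : ℝ) / √Real.pi * Real.cos (2 * √t - Real.pi / 4)| ≤
      t ^ (-(3 / 4) : ℝ) / (16 * √Real.pi) := by
  have hz : 0 < 2 * √t := by positivity
  have hpi := Real.pi_pos
  have h := abs_besselJZero_sub_le hz
  have e : ∀ p : ℝ, (1 / (2 * √t)) ^ p = 2 ^ (-p) * t ^ (-(p / 2)) := by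
    intro p
    rw [one_div, Real.inv_rpow hz.le, ← Real.rpow_neg hz.le,
      Real.mul_rpow two_pos.le (Real.sqrt_nonneg _), Real.sqrt_eq_rpow, ← Real.rpow_mul ht.le]
    congr 2
    ring
  have hs : √Real.pi * √Real.pi = Real.pi := Real.mul_self_sqrt hpi.le
  have hs0 : √Real.pi ≠ 0 := (Real.sqrt_pos.2 hpi).ne'
  have e1 : 2 / Real.pi * (2 ^ (-(1 / 2) : ℝ) * ((1 / (2 * √t)) ^ (1 / 2 : ℝ) * √Real.pi)) =
      t ^ (-(1 / 4) : ℝ) / √Real.pi := by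
    have : (2 : ℝ) ^ (-(1 / 2) : ℝ) * 2 ^ (-(1 / 2) : ℝ) = 1 / 2 := by
      rw [← Real.rpow_add two_pos]; norm_num
    rw [e, show (1 / 2 / 2 : ℝ) = 1 / 4 by norm_num]
    nth_rewrite 1 [← hs]
    field_simp
    linear_combination 2 * this
  have e2 : 2 / Real.pi * (2 ^ (-(5 / 2) : ℝ) * ((1 / (2 * √t)) ^ (3 / 2 : ℝ) * (√Real.pi / 2))) =
      t ^ (-(3 / 4) : ℝ) / (16 * √Real.pi) := by
    have : (2 : ℝ) ^ (-(5 / 2) : ℝ) * 2 ^ (-(3 / 2) : ℝ) = 1 / 16 := by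
      rw [← Real.rpow_add two_pos]; norm_num
    rw [e, show (3 / 2 / 2 : ℝ) = 3 / 4 by norm_num]
    nth_rewrite 1 [← hs]
    field_simp
    linear_combination 16 * this
  rwa [e1, e2] at h

/-! ### Gamma averages of oscillating exponentials -/

/-- Wendel's inequality, from the logarithmic convexity of the Gamma function. -/
lemma Gamma_add_le_rpow_mul_Gamma {x s : ℝ} (hx : 0 < x) (hs : 0 < s) (hs1 : s < 1) :
    Real.Gamma (x + s) ≤ x ^ s * Real.Gamma x := by
  have h := Real.Gamma_mul_add_mul_le_rpow_Gamma_mul_rpow_Gamma hx (show 0 < x + 1 by linarith)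
    (show 0 < 1 - s by linarith) hs (by ring)
  have hG := Real.Gamma_pos_of_pos hx
  rw [Real.Gamma_add_one hx.ne', Real.mul_rpow hx.le hG.le] at h
  calc Real.Gamma (x + s) = Real.Gamma ((1 - s) * x + s * (x + 1)) := by ring_nf
    _ ≤ _ := h
    _ = x ^ s * (Real.Gamma x ^ (1 - s) * Real.Gamma x ^ s) := by ring
    _ = _ := by rw [← Real.rpow_add hG]; simp

lemma Gamma_natCast_add_le {n : ℕ} (hn : 1 ≤ n) {s : ℝ} (hs : 0 < s) (hs1 : s < 1) :
    Real.Gamma (n + s) ≤ (n : ℝ) ^ (s - 1) * n.factorial := by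
  have hn0 : (0 : ℝ) < n := by exact_mod_cast hn
  have h := Gamma_add_le_rpow_mul_Gamma hn0 hs hs1
  rw [← Real.Gamma_nat_eq_factorial, Real.Gamma_add_one hn0.ne', ← mul_assoc,
    ← Real.rpow_add_one hn0.ne']
  simpa using h

lemma le_Gamma_natCast_add_three_quarters {n : ℕ} (hn : 1 ≤ n) :
    (1 - 3 / (16 * n)) * ((n : ℝ) ^ (-(1 / 4) : ℝ) * n.factorial) ≤ Real.Gamma (n + 3 / 4) := by
  have hn0 : (0 : ℝ) < n := by exact_mod_cast hn
  have h := Gamma_add_le_rpow_mul_Gamma (x := n + 3 / 4) (s := 1 / 4) (by positivity)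
    (by norm_num) (by norm_num)
  rw [show (n : ℝ) + 3 / 4 + 1 / 4 = n + 1 by ring, Real.Gamma_nat_eq_factorial] at h
  have hG := Real.Gamma_pos_of_pos (show 0 < (n : ℝ) + 3 / 4 by positivity)
  have h2 : ((n : ℝ) + 3 / 4) ^ (1 / 4 : ℝ) ≤ (n : ℝ) ^ (1 / 4 : ℝ) * (1 + 3 / (16 * n)) := by
    have e : (n : ℝ) + 3 / 4 = n * (1 + 3 / (4 * n)) := by field_simp
    rw [e, Real.mul_rpow hn0.le (by positivity)]
    gcongr
    refine (rpow_one_add_le_one_add_mul_self (by have : 0 < 3 / (4 * (n : ℝ)) := by positivity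
                                                 linarith) (by norm_num) (by norm_num)).trans
      (le_of_eq ?_)
    field_simp
    ring
  have h3 : (n : ℝ) ^ (-(1 / 4) : ℝ) * (n : ℝ) ^ (1 / 4 : ℝ) = 1 := by
    rw [← Real.rpow_add hn0]; simp
  have hx : (3 : ℝ) / (16 * n) ≤ 1 := by
    rw [div_le_one (by positivity)]
    have : (1 : ℝ) ≤ n := by exact_mod_cast hn
    linarith
  set x : ℝ := 3 / (16 * n)
  have hx0 : 0 ≤ x := by positivity
  calc (1 - x) * ((n : ℝ) ^ (-(1 / 4) : ℝ) * n.factorial)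
      ≤ (1 - x) * ((n : ℝ) ^ (-(1 / 4) : ℝ) *
        ((n : ℝ) ^ (1 / 4 : ℝ) * (1 + x) * Real.Gamma (n + 3 / 4))) := by
        have : 0 ≤ 1 - x := by linarith
        gcongr
        exact h.trans (by gcongr)
    _ = (1 - x ^ 2) * Real.Gamma (n + 3 / 4) := by
        linear_combination ((1 - x) * (1 + x) * Real.Gamma (n + 3 / 4)) * h3
    _ ≤ _ := by nlinarith [sq_nonneg x]

/-- The term `1 / 4` improves on what `Γ(n + 5/4) ≥ √n Γ(n + 3/4)` gives; it makes the second moment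
in `integral_exp_neg_mul_rpow_mul_sq_le` at most `1 / 2` instead of `3 / 4`. -/
lemma two_mul_add_mul_Gamma_le {n : ℝ} (hn1 : 1 ≤ n) :
    (2 * n + 1 / 4) * Real.Gamma (n + 3 / 4) ≤ 2 * √n * Real.Gamma (n + 5 / 4) := by
  have hn : 0 < n := by linarith
  have h := Gamma_add_le_rpow_mul_Gamma (x := n + 5 / 4) (s := 1 / 2) (by positivity)
    (by norm_num) (by norm_num)
  rw [show n + 5 / 4 + 1 / 2 = n + 3 / 4 + 1 by ring, Real.Gamma_add_one (by positivity),
    ← Real.sqrt_eq_rpow] at h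
  have hG := Real.Gamma_pos_of_pos (show 0 < n + 3 / 4 by positivity)
  have hG2 := Real.Gamma_pos_of_pos (show 0 < n + 5 / 4 by positivity)
  have hq : 0 < √(n + 5 / 4) := by positivity
  have h2 : (2 * n + 1 / 4) * √(n + 5 / 4) ≤ 2 * √n * (n + 3 / 4) := by
    refine le_of_sq_le_sq ?_ (by positivity)
    rw [mul_pow, mul_pow, mul_pow, Real.sq_sqrt (by positivity), Real.sq_sqrt hn.le]
    nlinarith
  refine le_of_mul_le_mul_left ?_ hq
  calc √(n + 5 / 4) * ((2 * n + 1 / 4) * Real.Gamma (n + 3 / 4))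
      = (2 * n + 1 / 4) * √(n + 5 / 4) * Real.Gamma (n + 3 / 4) := by ring
    _ ≤ 2 * √n * (n + 3 / 4) * Real.Gamma (n + 3 / 4) := by gcongr
    _ = 2 * √n * ((n + 3 / 4) * Real.Gamma (n + 3 / 4)) := by ring
    _ ≤ 2 * √n * (√(n + 5 / 4) * Real.Gamma (n + 5 / 4)) := by gcongr
    _ = _ := by ring

/-- Linearizing the phase `2√t` at `t = c²`: the remainder is exactly `-(√t - c)² / c`. -/
lemma norm_exp_two_mul_sqrt_sub_le {c t : ℝ} (hc : 0 < c) (ht : 0 ≤ t) :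
    ‖Complex.exp ((2 * √t : ℝ) * Complex.I) - Complex.exp ((c + t / c : ℝ) * Complex.I)‖ ≤
      (√t - c) ^ 2 / c := by
  have e : Complex.exp ((2 * √t : ℝ) * Complex.I) - Complex.exp ((c + t / c : ℝ) * Complex.I) =
      Complex.exp ((c + t / c : ℝ) * Complex.I) *
        (Complex.exp (Complex.I * ((2 * √t - (c + t / c) : ℝ) : ℂ)) - 1) := by
    rw [mul_sub, ← Complex.exp_add, mul_one]
    congr 2
    push_cast
    ring
  rw [e, norm_mul, Complex.norm_exp_ofReal_mul_I, one_mul]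
  refine Real.norm_exp_I_mul_ofReal_sub_one_le.trans (le_of_eq ?_)
  have : 2 * √t - (c + t / c) = -((√t - c) ^ 2 / c) := by
    field_simp
    nlinarith [Real.sq_sqrt ht]
  rw [this, norm_neg, Real.norm_of_nonneg (by positivity)]

lemma integral_exp_neg_mul_rpow_mul_sq_le {n : ℝ} (hn1 : 1 ≤ n) :
    IntegrableOn (fun t : ℝ => Real.exp (-t) * t ^ (n - 1 / 4) * ((√t - √n) ^ 2 / √n)) (Ioi 0) ∧
    ∫ t in Ioi (0 : ℝ), Real.exp (-t) * t ^ (n - 1 / 4) * ((√t - √n) ^ 2 / √n) ≤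
      1 / (2 * √n) * Real.Gamma (n + 3 / 4) := by
  have hn : 0 < n := by linarith
  have hc : 0 < √n := by positivity
  have e : ∀ t ∈ Ioi (0 : ℝ), (1 / √n) * ((Real.exp (-t) * t ^ ((n + 7 / 4) - 1) -
      2 * √n * (Real.exp (-t) * t ^ ((n + 5 / 4) - 1))) +
      n * (Real.exp (-t) * t ^ ((n + 3 / 4) - 1))) =
      Real.exp (-t) * t ^ (n - 1 / 4) * ((√t - √n) ^ 2 / √n) := by
    intro t ht
    have ht : 0 < t := ht
    have e1 : t ^ ((n + 7 / 4) - 1) = t ^ (n - 1 / 4) * t := by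
      rw [← Real.rpow_add_one ht.ne']; ring_nf
    have e2 : t ^ ((n + 5 / 4) - 1) = t ^ (n - 1 / 4) * √t := by
      rw [Real.sqrt_eq_rpow, ← Real.rpow_add ht]; ring_nf
    have e3 : t ^ ((n + 3 / 4) - 1) = t ^ (n - 1 / 4) := by ring_nf
    rw [e1, e2, e3, sub_sq, Real.sq_sqrt ht.le, Real.sq_sqrt hn.le]
    ring
  have i1 := Real.GammaIntegral_convergent (show 0 < n + 7 / 4 by positivity)
  have i2 := (Real.GammaIntegral_convergent (show 0 < n + 5 / 4 by positivity)).const_mul (2 * √n)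
  have i3 := (Real.GammaIntegral_convergent (show 0 < n + 3 / 4 by positivity)).const_mul n
  have i12 : IntegrableOn (fun t : ℝ => Real.exp (-t) * t ^ ((n + 7 / 4) - 1) -
      2 * √n * (Real.exp (-t) * t ^ ((n + 5 / 4) - 1))) (Ioi 0) := i1.sub i2
  refine ⟨IntegrableOn.congr_fun ((i12.add i3).const_mul (1 / √n)) e measurableSet_Ioi, ?_⟩
  rw [← setIntegral_congr_fun measurableSet_Ioi e, integral_const_mul,
    integral_add i12 i3, integral_sub i1 i2, integral_const_mul, integral_const_mul,
    ← Real.Gamma_eq_integral (by positivity), ← Real.Gamma_eq_integral (by positivity),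
    ← Real.Gamma_eq_integral (by positivity), show n + 7 / 4 = n + 3 / 4 + 1 by ring,
    Real.Gamma_add_one (by positivity)]
  have h := two_mul_add_mul_Gamma_le hn1
  calc _ ≤ 1 / √n * (1 / 2 * Real.Gamma (n + 3 / 4)) := by
        gcongr
        linarith
    _ = _ := by field_simp

/-- After linearization of the phase, the Gamma average of `exp (2i√t)` is a Gamma integral at the
complex rate `1 - i/√n`. -/
lemma norm_integral_exp_two_mul_sqrt_sub_le {n : ℝ} (hn1 : 1 ≤ n) :
    ‖(∫ t in Ioi (0 : ℝ), ((Real.exp (-t) * t ^ (n - 1 / 4) : ℝ) : ℂ) *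
        Complex.exp ((2 * √t : ℝ) * Complex.I)) -
      Complex.exp (√n * Complex.I) * ((1 / (1 - Complex.I / √n)) ^ ((n + 3 / 4 : ℝ) : ℂ) *
        Real.Gamma (n + 3 / 4))‖ ≤ 1 / (2 * √n) * Real.Gamma (n + 3 / 4) := by
  have hn : 0 < n := by linarith
  have hc : 0 < √n := by positivity
  have hre : 0 < (1 - Complex.I / √n : ℂ).re := by simp [Complex.div_re]
  have hI := integral_rpow_mul_cexp (a := n + 3 / 4) (by positivity) hre
  have iG := Real.GammaIntegral_convergent (show 0 < n + 3 / 4 by positivity)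
  rw [show n + 3 / 4 - 1 = n - 1 / 4 by ring] at hI iG
  have hmeas : ∀ f : ℝ → ℝ, Measurable f → IntegrableOn (fun t : ℝ =>
      ((Real.exp (-t) * t ^ (n - 1 / 4) : ℝ) : ℂ) * Complex.exp (f t * Complex.I)) (Ioi 0) := by
    intro f hf
    refine Integrable.mono iG (Measurable.aestronglyMeasurable (by fun_prop)) ?_
    refine Eventually.of_forall fun t => ?_
    rw [norm_mul, Complex.norm_exp_ofReal_mul_I, mul_one, Complex.norm_real]
  have i1 := hmeas (fun t => 2 * √t) (by fun_prop)
  have i2 := hmeas (fun t => √n + t / √n) (by fun_prop)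
  have e : Complex.exp (√n * Complex.I) * ((1 / (1 - Complex.I / √n)) ^ ((n + 3 / 4 : ℝ) : ℂ) *
        Real.Gamma (n + 3 / 4)) = ∫ t in Ioi (0 : ℝ), ((Real.exp (-t) * t ^ (n - 1 / 4) : ℝ) : ℂ) *
        Complex.exp ((√n + t / √n : ℝ) * Complex.I) := by
    rw [← hI, ← integral_const_mul]
    refine setIntegral_congr_fun measurableSet_Ioi fun t _ => ?_
    simp only [Complex.ofReal_mul, Complex.ofReal_exp]
    rw [mul_left_comm, ← Complex.exp_add, mul_comm (Complex.exp _), mul_assoc, ← Complex.exp_add]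
    congr 2
    push_cast
    ring
  rw [e, ← integral_sub i1 i2]
  have hE := integral_exp_neg_mul_rpow_mul_sq_le hn1
  refine (norm_integral_le_of_norm_le hE.1 ?_).trans hE.2
  refine (ae_restrict_mem measurableSet_Ioi).mono fun t ht => ?_
  have ht : 0 < t := ht
  rw [← mul_sub, norm_mul, Complex.norm_real, Real.norm_of_nonneg (by positivity)]
  gcongr
  exact norm_exp_two_mul_sqrt_sub_le hc ht.le

lemma sub_cube_le_arctan {x : ℝ} (hx : 0 ≤ x) : x - x ^ 3 / 3 ≤ Real.arctan x := by
  have hm : MonotoneOn (fun x : ℝ => Real.arctan x - (x - x ^ 3 / 3)) (Ici 0) := by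
    have hd : ∀ x : ℝ, HasDerivAt (fun x : ℝ => Real.arctan x - (x - x ^ 3 / 3))
        (1 / (1 + x ^ 2) - (1 - x ^ 2)) x := by
      intro x
      have h3 := (hasDerivAt_pow 3 x).div_const 3
      have := (Real.hasDerivAt_arctan x).sub ((hasDerivAt_id x).sub h3)
      exact this.congr_deriv (by norm_num)
    refine monotoneOn_of_deriv_nonneg (convex_Ici 0)
      (fun x _ => (hd x).continuousAt.continuousWithinAt)
      (fun x _ => (hd x).differentiableAt.differentiableWithinAt) fun x _ => ?_
    rw [(hd x).deriv, sub_nonneg, le_div_iff₀ (by positivity)]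
    nlinarith [sq_nonneg (x ^ 2)]
  have := hm (mem_Ici.2 le_rfl) (mem_Ici.2 hx) hx
  simp at this
  linarith

/-- Polar form of the complex power. -/
lemma one_div_one_sub_mul_I_cpow (h a : ℝ) :
    (1 / (1 - Complex.I * h)) ^ (a : ℂ) =
      Complex.exp ((-(a / 2 * Real.log (1 + h ^ 2)) : ℝ) + (a * Real.arctan h : ℝ) * Complex.I) := by
  set w : ℂ := (-(1 / 2 * Real.log (1 + h ^ 2)) : ℝ) + (Real.arctan h : ℝ) * Complex.I with hw
  have hp : 0 < 1 + h ^ 2 := by positivity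
  have hs : √(1 + h ^ 2) ≠ 0 := by positivity
  have hss : ((√(1 + h ^ 2) : ℝ) : ℂ) * ((√(1 + h ^ 2) : ℝ) : ℂ) = 1 + h ^ 2 := by
    rw [← Complex.ofReal_mul, Real.mul_self_sqrt hp.le]; push_cast; rfl
  have hsC : ((√(1 + h ^ 2) : ℝ) : ℂ) ≠ 0 := by exact_mod_cast hs
  have hne : (1 - Complex.I * h : ℂ) ≠ 0 := by
    intro h0
    have := congrArg Complex.re h0
    simp at this
  have he : Complex.exp w = 1 / (1 - Complex.I * h) := by
    have e1 : Real.exp (-(1 / 2 * Real.log (1 + h ^ 2))) = 1 / √(1 + h ^ 2) := by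
      have : √(1 + h ^ 2) = Real.exp (1 / 2 * Real.log (1 + h ^ 2)) := by
        rw [Real.sqrt_eq_rpow, Real.rpow_def_of_pos hp, mul_comm]
      rw [this, Real.exp_neg, ← one_div]
    rw [hw, Complex.exp_add, ← Complex.ofReal_exp, e1, Complex.exp_mul_I, ← Complex.ofReal_cos,
      ← Complex.ofReal_sin, Real.cos_arctan, Real.sin_arctan, eq_div_iff hne]
    push_cast
    field_simp
    rw [pow_two, hss]
    linear_combination (-(h : ℂ) ^ 2) * Complex.I_mul_I
  have him : w.im = Real.arctan h := by
    simp only [hw, Complex.add_im, Complex.ofReal_im, Complex.im_ofReal_mul, Complex.I_im, mul_one,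
      zero_add]
  have hlog : Complex.log (1 / (1 - Complex.I * h)) = w := by
    rw [← he, Complex.log_exp]
    · rw [him]; linarith [Real.neg_pi_div_two_lt_arctan h, Real.pi_pos]
    · rw [him]; linarith [Real.arctan_lt_pi_div_two h, Real.pi_pos]
  rw [Complex.cpow_def_of_ne_zero (one_div_ne_zero hne), hlog, hw]
  congr 1
  push_cast
  ring

lemma norm_exp_sub_one_le_of_nonpos {x y : ℝ} (hx : x ≤ 0) :
    ‖Complex.exp (x + y * Complex.I) - 1‖ ≤ |y| - x := by
  have e : Complex.exp (x + y * Complex.I) - 1 =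
      (Real.exp x : ℝ) * (Complex.exp (Complex.I * y) - 1) + ((Real.exp x - 1 : ℝ) : ℂ) := by
    rw [Complex.exp_add, mul_comm (y : ℂ)]
    push_cast
    ring
  have h1 : Real.exp x ≤ 1 := Real.exp_le_one_iff.2 hx
  rw [e]
  refine (norm_add_le _ _).trans ?_
  rw [norm_mul, Complex.norm_real, Complex.norm_real, Real.norm_of_nonneg (Real.exp_nonneg x),
    Real.norm_of_nonpos (by linarith)]
  have h2 : ‖Complex.exp (Complex.I * y) - 1‖ ≤ |y| := Real.norm_exp_I_mul_ofReal_sub_one_le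
  have h3 := mul_le_mul h1 h2 (norm_nonneg _) zero_le_one
  linarith [Real.add_one_le_exp x]

/-- The complex power is asymptotic to `e^{-1/2} e^{i√n}`. With `x + iy` the logarithm of the ratio
of the two sides, both `-x` and `|y|` are `O(1/√n)`, and `x ≤ 0`. -/
lemma norm_exp_mul_cpow_sub_le {n : ℝ} (hn : 1 ≤ n) :
    ‖Complex.exp (√n * Complex.I) * (1 / (1 - Complex.I / √n)) ^ ((n + 3 / 4 : ℝ) : ℂ) -
      (Real.exp (-(1 / 2)) : ℝ) * Complex.exp ((2 * √n : ℝ) * Complex.I)‖ ≤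
      Real.exp (-(1 / 2)) * (9 / 8 / √n) := by
  have hn0 : 0 < n := by linarith
  have hc : 0 < √n := by positivity
  have hcc : √n ^ 2 = n := Real.sq_sqrt hn0.le
  have hc1 : 1 ≤ √n := Real.one_le_sqrt.2 hn
  have e0 : (Complex.I / √n : ℂ) = Complex.I * ((1 / √n : ℝ) : ℂ) := by push_cast; ring
  have hh2 : (1 / √n) ^ 2 = 1 / n := by rw [div_pow, hcc, one_pow]
  set x : ℝ := 1 / 2 - (n + 3 / 4) / 2 * Real.log (1 + (1 / √n) ^ 2) with hx
  set y : ℝ := (n + 3 / 4) * Real.arctan (1 / √n) - √n with hy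
  have e1 : Complex.exp (√n * Complex.I) * (1 / (1 - Complex.I / √n)) ^ ((n + 3 / 4 : ℝ) : ℂ) -
      (Real.exp (-(1 / 2)) : ℝ) * Complex.exp ((2 * √n : ℝ) * Complex.I) =
      (Real.exp (-(1 / 2)) : ℝ) * Complex.exp ((2 * √n : ℝ) * Complex.I) *
        (Complex.exp (x + y * Complex.I) - 1) := by
    rw [e0, one_div_one_sub_mul_I_cpow, mul_sub, mul_one, Complex.ofReal_exp, ← Complex.exp_add,
      ← Complex.exp_add, ← Complex.exp_add, hx, hy]
    congr 2
    push_cast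
    ring
  have hx0 : x ≤ 0 := by
    have h1 := Real.le_log_one_add_of_nonneg (x := 1 / n) (by positivity)
    have h2 : 1 / (n + 3 / 4) ≤ 2 * (1 / n) / (1 / n + 2) := by
      rw [div_le_div_iff₀ (by positivity) (by positivity)]
      field_simp
      nlinarith
    have h3 := h2.trans h1
    rw [div_le_iff₀ (by positivity)] at h3
    rw [hx, hh2]
    linarith
  have hx1 : -x ≤ 3 / 8 / √n := by
    have h1 : Real.log (1 + 1 / n) ≤ 1 / n := by
      have := Real.log_le_sub_one_of_pos (show 0 < 1 + 1 / n by positivity)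
      linarith
    have h2 : (n + 3 / 4) / 2 * Real.log (1 + 1 / n) ≤ (n + 3 / 4) / 2 * (1 / n) := by gcongr
    have h3 : (n + 3 / 4) / 2 * (1 / n) = 1 / 2 + 3 / 8 / n := by field_simp; ring
    have h4 : 3 / 8 / n ≤ 3 / 8 / √n := by
      gcongr
      nlinarith
    rw [hx, hh2]
    linarith
  have hy1 : |y| ≤ 3 / 4 / √n := by
    have hp : 0 < 1 / √n := by positivity
    have h1 : Real.arctan (1 / √n) ≤ 1 / √n := by
      have := Real.lt_tan (Real.arctan_pos.2 hp) (Real.arctan_lt_pi_div_two _)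
      rw [Real.tan_arctan] at this
      exact this.le
    have h2 := sub_cube_le_arctan hp.le
    have h3 : (n + 3 / 4) * (1 / √n) = √n + 3 / 4 / √n := by
      field_simp; nlinarith
    have h4 : (n + 3 / 4) * (1 / √n - (1 / √n) ^ 3 / 3) =
        √n + 3 / 4 / √n - (1 / √n) * (1 + 3 / 4 / n) / 3 := by
      rw [mul_sub, h3, pow_succ, hh2]
      field_simp
    have h5 := mul_le_mul_of_nonneg_left h1 (show 0 ≤ n + 3 / 4 by positivity)
    have h6 := mul_le_mul_of_nonneg_left h2 (show 0 ≤ n + 3 / 4 by positivity)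
    have h7 : 1 + 3 / 4 / n ≤ 2 := by
      have : 3 / 4 / n ≤ 1 := by rw [div_le_one hn0]; linarith
      linarith
    have h8 : (1 / √n) * (1 + 3 / 4 / n) ≤ (1 / √n) * 2 := by gcongr
    have h9 : 3 / 4 / √n = 3 / 4 * (1 / √n) := by ring
    rw [h9] at h3 h4 ⊢
    rw [abs_le]
    constructor
    · rw [hy]; linarith
    · rw [hy]; linarith
  rw [e1, norm_mul, norm_mul, Complex.norm_exp_ofReal_mul_I, mul_one, Complex.norm_real,
    Real.norm_of_nonneg (Real.exp_nonneg _)]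
  gcongr
  refine (norm_exp_sub_one_le_of_nonpos hx0).trans ?_
  have : 9 / 8 / √n = 3 / 4 / √n + 3 / 8 / √n := by ring
  linarith

/-! ### Collecting the errors -/

/-- The Gamma average of `t^{-1/4} exp (2i√t)`, not divided by `n!`, with its leading term. The
constant `21 / 16` is `9 / 8 + 3 / 16`: the first part comes from the complex power, the second from
replacing `Γ(n + 3/4)` by `n^{-1/4} n!`. -/
lemma norm_integral_sub_leading_le {n : ℕ} (hn : 1 ≤ n) :
    ‖(∫ t in Ioi (0 : ℝ), ((Real.exp (-t) * t ^ ((n : ℝ) - 1 / 4) : ℝ) : ℂ) *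
        Complex.exp ((2 * √t : ℝ) * Complex.I)) -
      ((n : ℝ) ^ (-(1 / 4) : ℝ) * n.factorial * Real.exp (-(1 / 2)) : ℝ) *
        Complex.exp ((2 * √n : ℝ) * Complex.I)‖ ≤
      (1 / 2 + 21 / 16 * Real.exp (-(1 / 2))) * ((n : ℝ) ^ (-(3 / 4) : ℝ) * n.factorial) := by
  have hn1 : (1 : ℝ) ≤ n := by exact_mod_cast hn
  have hn0 : (0 : ℝ) < n := by linarith
  have hc : 0 < √(n : ℝ) := by positivity
  have hc1 : 1 ≤ √(n : ℝ) := Real.one_le_sqrt.2 hn1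
  have hcc : √(n : ℝ) ^ 2 = n := Real.sq_sqrt hn0.le
  have hA := norm_integral_exp_two_mul_sqrt_sub_le hn1
  have hB := norm_exp_mul_cpow_sub_le hn1
  set I := ∫ t in Ioi (0 : ℝ), ((Real.exp (-t) * t ^ ((n : ℝ) - 1 / 4) : ℝ) : ℂ) *
        Complex.exp ((2 * √t : ℝ) * Complex.I)
  set G := Real.Gamma ((n : ℝ) + 3 / 4) with hG
  set q := (n : ℝ) ^ (-(1 / 4) : ℝ) * n.factorial with hq
  set E := Real.exp (-(1 / 2))
  set u := Complex.exp ((2 * √n : ℝ) * Complex.I)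
  set v := Complex.exp (√n * Complex.I) * (1 / (1 - Complex.I / √n)) ^ ((n + 3 / 4 : ℝ) : ℂ)
  have hu : ‖u‖ = 1 := Complex.norm_exp_ofReal_mul_I _
  have hE : 0 < E := Real.exp_pos _
  have hG0 : 0 < G := Real.Gamma_pos_of_pos (by positivity)
  have hq0 : 0 < q := by positivity
  have hGq : G ≤ q := by
    have := Gamma_natCast_add_le hn (s := 3 / 4) (by norm_num) (by norm_num)
    rwa [show (3 / 4 : ℝ) - 1 = -(1 / 4) by norm_num] at this
  have hqG : q - G ≤ 3 / 16 / √n * q := by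
    have h1 := le_Gamma_natCast_add_three_quarters hn
    have h2 : (3 : ℝ) / (16 * n) ≤ 3 / 16 / √n := by
      rw [div_div]
      gcongr
      nlinarith
    have h3 := mul_le_mul_of_nonneg_right h2 hq0.le
    rw [← hG, ← hq] at h1
    linarith
  have hqn : (n : ℝ) ^ (-(3 / 4) : ℝ) * n.factorial = q / √n := by
    rw [hq, Real.sqrt_eq_rpow, mul_div_right_comm, ← Real.rpow_sub hn0]
    norm_num
  -- Three errors: linearized phase, complex power, and Gamma quotient.
  have hdec : I - ((q * E : ℝ) : ℂ) * u = (I - Complex.exp (√n * Complex.I) *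
      ((1 / (1 - Complex.I / √n)) ^ ((n + 3 / 4 : ℝ) : ℂ) * G)) +
      (v - (E : ℝ) * u) * G - ((E * (q - G) : ℝ) : ℂ) * u := by
    simp only [v]
    push_cast
    ring
  rw [hdec, hqn]
  refine (norm_sub_le _ _).trans ?_
  refine (add_le_add_left (norm_add_le _ _) _).trans ?_
  rw [norm_mul, norm_mul, hu, mul_one, Complex.norm_real, Complex.norm_real,
    Real.norm_of_nonneg hG0.le, Real.norm_of_nonneg (mul_nonneg hE.le (by linarith))]
  calc _ ≤ 1 / (2 * √n) * q + E * (9 / 8 / √n) * q + E * (3 / 16 / √n * q) := by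
        gcongr
        exact hA.trans (by gcongr)
    _ = _ := by ring

lemma integrableOn_exp_neg_mul_rpow_mul_cos {s : ℝ} (hs : -1 < s) :
    IntegrableOn (fun t : ℝ => Real.exp (-t) * t ^ s * Real.cos (2 * √t - Real.pi / 4)) (Ioi 0) := by
  have h := Real.GammaIntegral_convergent (s := s + 1) (by linarith)
  rw [add_sub_cancel_right] at h
  refine Integrable.mono h (Measurable.aestronglyMeasurable (by fun_prop)) ?_
  refine Eventually.of_forall fun t => ?_
  rw [norm_mul]
  exact mul_le_of_le_one_right (norm_nonneg _) (Real.abs_cos_le_one _)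

lemma measurable_besselJZero : Measurable besselJZero := by
  refine Measurable.const_mul ?_ _
  refine Continuous.measurable ?_
  refine intervalIntegral.continuous_parametric_intervalIntegral_of_continuous' ?_ _ _
  fun_prop

/-- The error of the Bessel asymptotics, of size `t^{-3/4}`, is averaged with
`Γ(n + 1/4) ≤ n^{-3/4} n!`. -/
lemma abs_integral_besselJZero_sub_le {n : ℕ} (hn : 1 ≤ n) :
    |(∫ t in Ioi (0 : ℝ), Real.exp (-t) * t ^ n * besselJZero (2 * √t)) -
      1 / √Real.pi * ∫ t in Ioi (0 : ℝ), Real.exp (-t) * t ^ ((n : ℝ) - 1 / 4) *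
        Real.cos (2 * √t - Real.pi / 4)| ≤
      1 / (16 * √Real.pi) * ((n : ℝ) ^ (-(3 / 4) : ℝ) * n.factorial) := by
  have hn0 : (0 : ℝ) < n := by exact_mod_cast hn
  have hpi := Real.pi_pos
  have i2 := (integrableOn_exp_neg_mul_rpow_mul_cos (s := n - 1 / 4)
    (by linarith)).const_mul (1 / √Real.pi)
  have i3 := (Real.GammaIntegral_convergent (s := n + 1 / 4) (by positivity)).const_mul
    (1 / (16 * √Real.pi))
  have hb : ∀ t ∈ Ioi (0 : ℝ), ‖Real.exp (-t) * t ^ n * besselJZero (2 * √t) -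
      1 / √Real.pi * (Real.exp (-t) * t ^ ((n : ℝ) - 1 / 4) * Real.cos (2 * √t - Real.pi / 4))‖ ≤
      1 / (16 * √Real.pi) * (Real.exp (-t) * t ^ ((n : ℝ) + 1 / 4 - 1)) := by
    intro t ht
    have ht : 0 < t := ht
    have e1 : t ^ ((n : ℝ) - 1 / 4) = t ^ n * t ^ (-(1 / 4) : ℝ) := by
      rw [← Real.rpow_natCast, ← Real.rpow_add ht]; rfl
    have e2 : t ^ ((n : ℝ) + 1 / 4 - 1) = t ^ n * t ^ (-(3 / 4) : ℝ) := by
      rw [← Real.rpow_natCast, ← Real.rpow_add ht]; ring_nf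
    have e3 : Real.exp (-t) * t ^ n * besselJZero (2 * √t) -
      1 / √Real.pi * (Real.exp (-t) * t ^ ((n : ℝ) - 1 / 4) * Real.cos (2 * √t - Real.pi / 4)) =
      (Real.exp (-t) * t ^ n) * (besselJZero (2 * √t) -
        t ^ (-(1 / 4) : ℝ) / √Real.pi * Real.cos (2 * √t - Real.pi / 4)) := by
      rw [e1]; ring
    rw [e3, e2, norm_mul, Real.norm_of_nonneg (by positivity), Real.norm_eq_abs]
    calc _ ≤ (Real.exp (-t) * t ^ n) * (t ^ (-(3 / 4) : ℝ) / (16 * √Real.pi)) := by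
          gcongr
          exact abs_besselJZero_two_mul_sqrt_sub_le ht
      _ = _ := by ring
  have hb' := (ae_restrict_mem (μ := volume) (measurableSet_Ioi (a := (0 : ℝ)))).mono hb
  have i4 := Integrable.mono' i3 (by
    refine Measurable.aestronglyMeasurable ?_
    have := measurable_besselJZero
    fun_prop) hb'
  have i1 : IntegrableOn (fun t : ℝ => Real.exp (-t) * t ^ n * besselJZero (2 * √t)) (Ioi 0) :=
    (i4.add i2).congr (Eventually.of_forall fun t => sub_add_cancel _ _)
  rw [← integral_const_mul, ← integral_sub i1 i2]
  refine (norm_integral_le_of_norm_le i3 hb').trans ?_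
  rw [integral_const_mul, ← Real.Gamma_eq_integral (by positivity)]
  gcongr
  have := Gamma_natCast_add_le hn (s := 1 / 4) (by norm_num) (by norm_num)
  rwa [show (1 / 4 : ℝ) - 1 = -(3 / 4) by norm_num] at this

lemma abs_integral_cos_sub_le {n : ℕ} (hn : 1 ≤ n) :
    |(∫ t in Ioi (0 : ℝ), Real.exp (-t) * t ^ ((n : ℝ) - 1 / 4) *
        Real.cos (2 * √t - Real.pi / 4)) -
      (n : ℝ) ^ (-(1 / 4) : ℝ) * n.factorial * Real.exp (-(1 / 2)) *
        Real.cos (2 * √n - Real.pi / 4)| ≤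
      (1 / 2 + 21 / 16 * Real.exp (-(1 / 2))) * ((n : ℝ) ^ (-(3 / 4) : ℝ) * n.factorial) := by
  have hn0 : (0 : ℝ) < n := by exact_mod_cast hn
  have h := norm_integral_sub_leading_le hn
  set w : ℂ := Complex.exp ((-(Real.pi / 4) : ℝ) * Complex.I)
  have hw : ‖w‖ = 1 := Complex.norm_exp_ofReal_mul_I _
  have hre : ∀ r x : ℝ, ((r : ℂ) * Complex.exp ((x : ℝ) * Complex.I) * w).re =
      r * Real.cos (x - Real.pi / 4) := by
    intro r x
    rw [mul_assoc, ← Complex.exp_add, ← add_mul, ← Complex.ofReal_add, Complex.re_ofReal_mul,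
      Complex.exp_ofReal_mul_I_re]
    rfl
  have iI : IntegrableOn (fun t : ℝ => ((Real.exp (-t) * t ^ ((n : ℝ) - 1 / 4) : ℝ) : ℂ) *
        Complex.exp ((2 * √t : ℝ) * Complex.I) * w) (Ioi 0) := by
    have h := Real.GammaIntegral_convergent (s := n + 3 / 4) (by positivity)
    rw [show (n : ℝ) + 3 / 4 - 1 = n - 1 / 4 by ring] at h
    refine Integrable.mono h (Measurable.aestronglyMeasurable (by fun_prop)) ?_
    refine Eventually.of_forall fun t => ?_
    rw [norm_mul, norm_mul, Complex.norm_exp_ofReal_mul_I, hw, mul_one, mul_one, Complex.norm_real]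
  have hmul : ∀ x : ℂ, |(x * w).re| ≤ ‖x‖ := fun x =>
    (Complex.abs_re_le_norm _).trans_eq (by rw [norm_mul, hw, mul_one])
  have h1 := (hmul _).trans h
  rw [sub_mul, ← integral_mul_const] at h1
  rw [Complex.sub_re, hre, ← Complex.reCLM_apply, ← ContinuousLinearMap.integral_comp_comm _ iI] at h1
  simp only [Complex.reCLM_apply, hre] at h1
  exact h1

theorem theorem2 (n : ℕ) (hn : 1 ≤ n) :
    |padeQ n 1 - (-1 : ℝ) ^ n * Real.sqrt (Real.exp 1 / Real.pi) *
        ((Nat.factorial n : ℝ) / (n : ℝ) ^ (1 / 4 : ℝ)) *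
        Real.cos (2 * Real.sqrt (n : ℝ) - Real.pi / 4)|
      < 2.38 * (Nat.factorial n : ℝ) / (n : ℝ) ^ (3 / 4 : ℝ) := by
  have hn0 : (0 : ℝ) < n := by exact_mod_cast hn
  have hpi := Real.pi_pos
  have hJ := abs_integral_besselJZero_sub_le hn
  have hC := abs_integral_cos_sub_le hn
  rw [integral_exp_neg_mul_pow_mul_besselJZero] at hJ
  set S := ∑ j ∈ Finset.range (n + 1), (n.choose j : ℝ) * ((-1) ^ j / j.factorial)
  set K := ∫ t in Ioi (0 : ℝ), Real.exp (-t) * t ^ ((n : ℝ) - 1 / 4) *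
        Real.cos (2 * √t - Real.pi / 4)
  set B := (n : ℝ) ^ (-(3 / 4) : ℝ) * n.factorial with hB
  set C := Real.cos (2 * √n - Real.pi / 4)
  set q := (n : ℝ) ^ (-(1 / 4) : ℝ) * n.factorial with hq
  set s := √Real.pi with hs
  set E := Real.exp (1 / 2) with hE
  have hs0 : 0 < s := Real.sqrt_pos.2 hpi
  have hE0 : 0 < E := Real.exp_pos _
  have hB0 : 0 < B := by positivity
  have hE1 : Real.exp 1 = E ^ 2 := by rw [hE, ← Real.exp_nat_mul]; norm_num
  have hE2 : Real.exp (-1) = 1 / E ^ 2 := by rw [Real.exp_neg, hE1, one_div]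
  have hE3 : Real.exp (-(1 / 2)) = 1 / E := by rw [Real.exp_neg, ← hE, one_div]
  rw [hE2] at hJ
  rw [hE3] at hC
  have hsq : √(Real.exp 1 / Real.pi) = E / s := by
    rw [Real.sqrt_div' _ hpi.le, hE1, Real.sqrt_sq hE0.le]
  have hq' : (n.factorial : ℝ) / (n : ℝ) ^ (1 / 4 : ℝ) = q := by
    rw [hq, Real.rpow_neg hn0.le]; ring
  have hB' : 2.38 * (n.factorial : ℝ) / (n : ℝ) ^ (3 / 4 : ℝ) = 2.38 * B := by
    rw [hB, Real.rpow_neg hn0.le]; ring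
  have hEb : E < 1.65 := by
    refine lt_of_pow_lt_pow_left₀ 2 (by norm_num) ?_
    rw [← hE1]
    exact Real.exp_one_lt_d9.trans (by norm_num)
  have hsb : 1.77 < s := by
    rw [hs]
    refine Real.lt_sqrt_of_sq_lt ?_
    exact lt_trans (by norm_num) Real.pi_gt_d4
  rw [hsq, hq', hB', padeQ_one_eq]
  -- The leading factor is `√(e / π) = e · (1 / √π) · e^{-1/2}`.
  have e : (-1) ^ n * (n.factorial : ℝ) * S - (-1) ^ n * (E / s) * q * C =
      (-1) ^ n * (E ^ 2 * ((n.factorial * (1 / E ^ 2 * S) - 1 / s * K) +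
        1 / s * (K - q * (1 / E) * C))) := by
    field_simp
    ring
  rw [e, abs_mul, abs_pow, abs_neg, abs_one, one_pow, one_mul, abs_mul, abs_of_pos (by positivity)]
  have h1 : |1 / s * (K - q * (1 / E) * C)| ≤ 1 / s * ((1 / 2 + 21 / 16 * (1 / E)) * B) := by
    rw [abs_mul, abs_of_pos (by positivity)]
    gcongr
  calc _ ≤ E ^ 2 * (1 / (16 * s) * B + 1 / s * ((1 / 2 + 21 / 16 * (1 / E)) * B)) := by
        gcongr
        exact (abs_add_le _ _).trans (add_le_add hJ h1)
    _ = (9 / 16 * E ^ 2 + 21 / 16 * E) / s * B := by field_simp; ring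
    -- Numerically the constant is below `2.09`.
    _ < 2.38 * B := by
        gcongr
        rw [div_lt_iff₀ hs0]
        nlinarith
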